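/- **Theorem 4.** Let $C\subset\mathbb R^2$ be an axis-parallel rectangle ("cake") and let $1\le m\le n$. There are $n$ agents; agent $i$ has an integrable, non-negative and bounded value-density $v_i$ on $C$, and values a piece $A\subseteq C$ at $V_i(A)=\int_A v_i(x)\,dx$. Agents $1,\dots,m$ ("old" agents) currently hold pairwise-disjoint (up to boundaries) axis-parallel rectangles $Z_1,\dots,Z_m\subseteq C$, which need not cover $C$. A protocol knows $m,n,C,Z_1,\dots,Z_m$ and accesses the value measures only by queries, which the agents answer truthfully: an *eval* query asks an agent for its value of a given axis-parallel rectangle $R\subseteq C$; a *mark* query asks an agent to cut a given axis-parallel rectangle $R\subseteq C$ by a line parallel to a given axis so that the left (lower) part has a given value $a$, $0\le a\le V_i(R)$, for that agent. There is a universal constant $K$ such that for all such $m,n,C,Z_1,\dots,Z_m$ there is a protocol that, for all value-densities, after at most $K\,m\,n\log n$ queries, outputs pairwise-disjoint (up to boundaries) axis-parallel rectangles $X_1,\dots,X_n\subseteq C$ (not necessarily covering $C$), where agent $i$ receives $X_i$, such that 1. ($1/4$-proportionality) $V_i(X_i)\ge \frac{1}{4n}V_i(C)$ for every $i\in\{1,\dots,n\}$;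 2. (gradual retention) for every integer $k\in\{1,\dots,m\}$ there are at least $m-k$ indices $j\in\{1,\dots,m\}$ with $V_j(X_j)\ge \frac{1}{\lceil n/k\rceil}V_j(Z_j)$. -/

import Mathlib

namespace CakeRedivision

open MeasureTheory

/-- The plane. -/
abbrev Plane : Type := Fin 2 → ℝ

/-- An axis-parallel rectangle of positive width and height. As a set of points it is
`(a₀, b₀] × (a₁, b₁]`, so two rectangles that only share a part of their boundaries may be
disjoint; boundaries have zero value to all agents. -/
abbrev Rectangle : Type := BoxIntegral.Box (Fin 2)

/-- A value-density on the cake `C`: integrable, non-negative and bounded on `C`. -/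
structure IsValueDensity (C : Rectangle) (v : Plane → ℝ) : Prop where
  integrableOn : IntegrableOn v (C : Set Plane)
  nonneg : ∀ x ∈ C, 0 ≤ v x
  bounded : ∃ B : ℝ, ∀ x ∈ C, v x ≤ B

/-- The value of a piece to an agent with value-density `v`. -/
noncomputable def value (v : Plane → ℝ) (A : Set Plane) : ℝ :=
  ∫ x in A, v x

/-- A rectangular allocation of the cake `C` to `p` agents: one rectangle per agent, the rectangles
are contained in `C` and pairwise disjoint. Some of the cake may remain unallocated. -/
structure IsAllocation (C : Rectangle) {p : ℕ} (X : Fin p → Rectangle) : Prop where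
  subset : ∀ i, (X i : Set Plane) ⊆ (C : Set Plane)
  disjoint : ∀ i j, i ≠ j → Disjoint (X i : Set Plane) (X j : Set Plane)

/-- `r`-proportionality: each of the `n` agents gets at least `r / n` of its total cake value. -/
def IsProportional (r : ℝ) (C : Rectangle) {n : ℕ} (v : Fin n → Plane → ℝ)
    (X : Fin n → Rectangle) : Prop :=
  ∀ i, r / n * value (v i) C ≤ value (v i) (X i)

/-- Gradual retention. The old agents are the first `m` of the `n` agents. -/
def GradualRetention {m n : ℕ} (hmn : m ≤ n) (v : Fin n → Plane → ℝ)
    (Z : Fin m → Rectangle) (X : Fin n → Rectangle) : Prop :=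
  ∀ k : ℕ, 1 ≤ k → k ≤ m → ∃ J : Finset (Fin m), m - k ≤ J.card ∧ ∀ j ∈ J,
    1 / (⌈(n : ℝ) / k⌉₊ : ℝ) * value (v (Fin.castLE hmn j)) (Z j) ≤
      value (v (Fin.castLE hmn j)) (X (Fin.castLE hmn j))

/-- The part of the rectangle `R` on the lower side of the line on which coordinate `d` is `t`. -/
def lowerPart (R : Rectangle) (d : Fin 2) (t : ℝ) : Set Plane :=
  {x | x ∈ R ∧ x d ≤ t}

/-- A deterministic query protocol for `n` agents with outputs in `β`: a tree that at each internal
node asks one agent one query and continues according to the (real) answer.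
* `eval i R next`: agent `i` reveals its value for `R`;
* `mark i R d a next`: agent `i` cuts `R` at some coordinate `t` of the axis `d` so that the lower
  part of `R` has value `a`, and reveals `t`. -/
inductive Protocol (n : ℕ) (β : Type) : Type
  | done (out : β) : Protocol n β
  | eval (i : Fin n) (R : Rectangle) (next : ℝ → Protocol n β) : Protocol n β
  | mark (i : Fin n) (R : Rectangle) (d : Fin 2) (a : ℝ) (next : ℝ → Protocol n β) : Protocol n β

/-- `P.Achieves C v Good q`: when the agents have the value-densities `v` and answer truthfully,
the protocol `P` on the cake `C` stops after at most `q` queries with an output that is `Good`,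
whichever truthful answer is given where a mark query has several ones. Only legal queries may be
asked: they concern rectangles inside the cake, and the value asked for in a mark query lies between
zero and the value of the rectangle (so that a truthful answer exists). -/
def Protocol.Achieves {n : ℕ} {β : Type} (C : Rectangle) (v : Fin n → Plane → ℝ)
    (Good : β → Prop) : Protocol n β → ℕ → Prop
  | .done out, _ => Good out
  | .eval _ _ _, 0 => False
  | .eval i R next, q + 1 =>
      (R : Set Plane) ⊆ (C : Set Plane) ∧
      Protocol.Achieves C v Good (next (value (v i) R)) q
  | .mark _ _ _ _ _, 0 => False
  | .mark i R d a next, q + 1 =>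
      (R : Set Plane) ⊆ (C : Set Plane) ∧ 0 ≤ a ∧ a ≤ value (v i) R ∧
      ∀ t ∈ Set.Icc (R.lower d) (R.upper d), value (v i) (lowerPart R d t) = a →
        Protocol.Achieves C v Good (next t) q

end CakeRedivision

/-!
Sweeping a line across the cake, one extends the old rectangles along one axis until they are part
of a partition of the cake into at most `3 * m + 1` rectangles, the pieces, each of which contains
at most one of them. All agents evaluate all pieces. Agent `i` tolerates at the piece `j` up to
`⌊4 n V i j / V i C⌋` agents, itself included: if so many agents divide the piece proportionally,
`i` gets at least `V i C / (4 n)`. The sum of these quotas over the pieces exceeds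
`4 n - (3 m + 1) ≥ n - 1`, so an agent that has no piece always finds one which is not yet full for
it. Joining that piece, or replacing there an agent with a smaller quota, increases the total quota.
Hence among the stable partial assignments (no agent is at a piece too crowded for it, and an old
agent that is not at its own piece finds that piece full) one with the largest total quota assigns
all agents. Each piece is then divided among its agents by repeated halving.

If `N` agents are at the piece `j` of an old agent `i` that is elsewhere, then its quota there is at
most `N`, so `V i j ≤ (N + 1) V i C / (4 n)`, and `i` keeps the part `1 / (N + 1)` of its old value.
As the numbers `N` sum to at most `n`, at most `k` old pieces have `⌈n / k⌉` or more agents.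
-/

namespace CakeRedivision

open Finset Function MeasureTheory

section Assignment

variable {κ ι α : Type*} [Fintype κ]

lemma sum_apply_update_add {M : Type*} [AddCommMonoid M] [DecidableEq κ] (g : κ → α → M)
    (σ : κ → α) (i : κ) (a : α) :
    ∑ x, g x (update σ i a x) + g i (σ i) = ∑ x, g x (σ x) + g i a := by
  have hrest : ∑ x ∈ univ.erase i, g x (update σ i a x) = ∑ x ∈ univ.erase i, g x (σ x) :=
    sum_congr rfl fun x hx => by rw [update_of_ne (ne_of_mem_erase hx)]
  rw [← add_sum_erase _ _ (mem_univ i), ← add_sum_erase _ (fun x => g x (σ x)) (mem_univ i),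
    hrest, update_self, add_right_comm, add_comm (g i a), add_right_comm]

/-- The number of agents that the assignment `σ` sends to the piece `a`. Assignments that leave
agents unassigned take values in `Option ι`. -/
def load [DecidableEq α] (σ : κ → α) (a : α) : ℕ := #{i | σ i = a}

lemma load_update_add [DecidableEq κ] [DecidableEq α] (σ : κ → α) (i : κ) (a b : α) :
    load (update σ i a) b + (if σ i = b then 1 else 0) = load σ b + if a = b then 1 else 0 := by
  simpa only [load, card_filter] using
    sum_apply_update_add (fun _ c => if c = b then 1 else 0) σ i a

lemma sum_load [DecidableEq α] [Fintype α] (σ : κ → α) : ∑ a, load σ a = Fintype.card κ :=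
  (card_eq_sum_card_fiberwise fun _ _ => mem_univ _).symm

lemma load_pos [DecidableEq α] (σ : κ → α) (i : κ) : 0 < load σ (σ i) :=
  card_pos.2 ⟨i, by simp⟩

/-- The total quota, for the assigned agents, of the pieces that they are assigned to. -/
def totalQuota (q : κ → ι → ℕ) (σ : κ → Option ι) : ℕ := ∑ i, (σ i).elim 0 (q i)

lemma totalQuota_update_add [DecidableEq κ] (q : κ → ι → ℕ) (σ : κ → Option ι) (i : κ)
    (o : Option ι) :
    totalQuota q (update σ i o) + (σ i).elim 0 (q i) = totalQuota q σ + o.elim 0 (q i) :=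
  sum_apply_update_add (fun i o => o.elim 0 (q i)) σ i o

variable [DecidableEq ι] {R : Type*} [LinearOrder R]

/-- Stability of a partial assignment, where agent `i` tolerates up to `q i j` agents, itself
included, at the piece `j`: nobody is at a piece too crowded for it, and any piece that an agent
ranks higher than its own has no room left for it. -/
structure IsStable (q : κ → ι → ℕ) (rank : κ → ι → R) (σ : κ → Option ι) : Prop where
  load_le : ∀ i j, σ i = some j → load σ (some j) ≤ q i j
  le_load : ∀ i j k, σ i = some j → rank i j < rank i k → q i k ≤ load σ (some k)

variable {q : κ → ι → ℕ} {rank : κ → ι → R} {σ τ : κ → Option ι} {i x : κ} {j : ι}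

lemma exists_best_of_unassigned [Fintype ι] (rank : κ → ι → R) (hi : σ i = none)
    (hq : Fintype.card κ ≤ ∑ j, q i j) :
    ∃ j, load σ (some j) < q i j ∧ ∀ k, rank i j < rank i k → q i k ≤ load σ (some k) := by
  have hlt : ∑ j, load σ (some j) < ∑ j, q i j := by
    have hsum := sum_load σ
    have hnone := load_pos σ i
    rw [Fintype.sum_option] at hsum
    rw [hi] at hnone
    omega
  obtain ⟨k, -, hk⟩ := exists_lt_of_sum_lt hlt
  obtain ⟨j, hj, hmax⟩ :=
    exists_max_image {j | load σ (some j) < q i j} (rank i) ⟨k, by simpa using hk⟩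
  simp only [mem_filter, mem_univ, true_and] at hj hmax
  exact ⟨j, hj, fun k hk => not_lt.1 fun hlt => hk.not_ge (hmax k hlt)⟩

lemma IsStable.of_move (hσ : IsStable q rank σ) (hτi : τ i = some j)
    (hτ : ∀ y ≠ i, ∀ k, τ y = some k → σ y = some k)
    (hload : ∀ k, load σ (some k) ≤ load τ (some k))
    (hbest : ∀ k, rank i j < rank i k → q i k ≤ load σ (some k))
    (hle : ∀ y k, τ y = some k → load τ (some k) ≤ q y k) : IsStable q rank τ where
  load_le := hle
  le_load y k l hy hl := by
    refine le_trans ?_ (hload l)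
    by_cases hyi : y = i
    · subst hyi
      obtain rfl : j = k := Option.some_injective _ (hτi.symm.trans hy)
      exact hbest l hl
    · exact hσ.le_load y k l (hτ y hyi k hy) hl

lemma IsStable.exists_join (hσ : IsStable q rank σ) (hi : σ i = none)
    (hj : load σ (some j) < q i j)
    (hbest : ∀ k, rank i j < rank i k → q i k ≤ load σ (some k))
    (hroom : ∀ y, σ y = some j → load σ (some j) < q y j) :
    ∃ τ, IsStable q rank τ ∧ totalQuota q σ < totalQuota q τ := by
  classical
  have hload (k : ι) :
      load (update σ i (some j)) (some k) = load σ (some k) + if j = k then 1 else 0 := by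
    simpa [hi] using load_update_add σ i (some j) (some k)
  refine ⟨update σ i (some j), hσ.of_move (i := i) (j := j) (update_self ..)
    (fun y hy k hk => ?_) (fun k => ?_) hbest fun y k hk => ?_, ?_⟩
  · rwa [update_of_ne hy] at hk
  · exact (hload k).symm ▸ Nat.le_add_right _ _
  · rw [hload]
    by_cases hy : y = i
    · subst hy
      obtain rfl : j = k := by simpa using hk
      simpa using hj
    · rw [update_of_ne hy] at hk
      split_ifs with hjk
      · exact hjk ▸ hroom y (hjk ▸ hk)
      · exact hσ.load_le y k hk
  · have htotal := totalQuota_update_add q σ i (some j)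
    simp only [hi, Option.elim_none, Option.elim_some] at htotal
    omega

lemma IsStable.exists_replace (hσ : IsStable q rank σ) (hi : σ i = none)
    (hj : load σ (some j) < q i j)
    (hbest : ∀ k, rank i j < rank i k → q i k ≤ load σ (some k))
    (hx : σ x = some j) (hxj : q x j ≤ load σ (some j)) :
    ∃ τ, IsStable q rank τ ∧ totalQuota q σ < totalQuota q τ := by
  classical
  have hix : i ≠ x := by rintro rfl; simp [hi] at hx
  have hi' : update σ x none i = none := by rw [update_of_ne hix, hi]
  set τ := update (update σ x none) i (some j) with hτ
  have hτσ : ∀ y ≠ i, ∀ k, τ y = some k → σ y = some k := fun y hy k hk => by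
    rw [hτ, update_of_ne hy] at hk
    by_cases hyx : y = x
    · simp [hyx] at hk
    · rwa [update_of_ne hyx] at hk
  have hload (k : ι) : load τ (some k) = load σ (some k) := by
    have hleave := load_update_add σ x none (some k)
    have hjoin := load_update_add (update σ x none) i (some j) (some k)
    simp only [hx, hi', reduceCtorEq, if_false, add_zero] at hleave hjoin
    rw [← hτ] at hjoin
    omega
  refine ⟨τ, hσ.of_move (update_self ..) hτσ (fun k => (hload k).ge) hbest fun y k hk => ?_, ?_⟩
  · rw [hload]
    by_cases hy : y = i
    · subst hy
      obtain rfl : j = k := by simpa [hτ] using hk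
      exact hj.le
    · exact hσ.load_le y k (hτσ y hy k hk)
  · have hleave := totalQuota_update_add q σ x none
    have hjoin := totalQuota_update_add q (update σ x none) i (some j)
    simp only [hx, hi', Option.elim_none, Option.elim_some] at hleave hjoin
    rw [← hτ] at hjoin
    omega

variable [Fintype ι]

lemma IsStable.exists_totalQuota_lt (hσ : IsStable q rank σ)
    (hq : ∀ i, Fintype.card κ ≤ ∑ j, q i j) (hi : σ i = none) :
    ∃ τ, IsStable q rank τ ∧ totalQuota q σ < totalQuota q τ := by
  obtain ⟨j, hj, hbest⟩ := exists_best_of_unassigned rank hi (hq i)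
  by_cases hfull : ∃ x, σ x = some j ∧ q x j ≤ load σ (some j)
  · obtain ⟨x, hx, hxj⟩ := hfull
    exact hσ.exists_replace hi hj hbest hx hxj
  · push Not at hfull
    exact hσ.exists_join hi hj hbest hfull

lemma exists_isStable_some (rank : κ → ι → R) (hq : ∀ i, Fintype.card κ ≤ ∑ j, q i j) :
    ∃ σ : κ → ι, IsStable q rank fun i => some (σ i) := by
  classical
  have hne : (univ.filter fun σ => IsStable q rank σ).Nonempty :=
    ⟨fun _ => none, by rw [mem_filter]; exact ⟨mem_univ _, by simp, by simp⟩⟩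
  obtain ⟨σ, hσ, hmax⟩ := exists_max_image _ (totalQuota q) hne
  simp only [mem_filter, mem_univ, true_and] at hσ hmax
  have htotal : ∀ i, ∃ j, σ i = some j := fun i => by
    rw [← Option.ne_none_iff_exists']
    intro hi
    obtain ⟨τ, hτ, hlt⟩ := hσ.exists_totalQuota_lt hq hi
    exact (hmax τ hτ).not_gt hlt
  choose τ hτ using htotal
  exact ⟨τ, funext hτ ▸ hσ⟩

end Assignment

section FairAssignment

variable {κ ι : Type*} [Fintype κ] [Fintype ι]

lemma exists_floor_shares [Nonempty ι] (w : ι → ℝ) (hw : ∀ j, 0 ≤ w j) (N : ℕ) :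
    ∃ q : ι → ℕ, N < ∑ j, q j + Fintype.card ι ∧
      ∀ j, q j * ∑ k, w k ≤ N * w j ∧ N * w j ≤ (q j + 1) * ∑ k, w k := by
  rcases (sum_nonneg fun j _ => hw j).eq_or_lt' with hzero | hpos
  · have hw0 (j : ι) : w j = 0 := (sum_eq_zero_iff_of_nonneg fun j _ => hw j).1 hzero j (mem_univ j)
    refine ⟨fun _ => N, ?_, fun j => by simp [hw0]⟩
    have hcard : 0 < Fintype.card ι := Fintype.card_pos
    simp only [sum_const, card_univ, smul_eq_mul]
    nlinarith
  · set q : ι → ℕ := fun j => ⌊N * w j / ∑ k, w k⌋₊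
    have hlt (j : ι) : N * w j < (q j + 1) * ∑ k, w k :=
      (div_lt_iff₀ hpos).1 (Nat.lt_floor_add_one _)
    refine ⟨q, ?_, fun j => ⟨?_, (hlt j).le⟩⟩
    · have hsum : N * ∑ k, w k < (∑ j, ((q j : ℝ) + 1)) * ∑ k, w k := by
        rw [mul_sum, sum_mul]
        exact sum_lt_sum_of_nonempty univ_nonempty fun j _ => hlt j
      have hN := lt_of_mul_lt_mul_right hsum hpos.le
      rw [sum_add_distrib, sum_const, card_univ, nsmul_one] at hN
      exact_mod_cast hN
    · exact (le_div_iff₀ hpos).1 (Nat.floor_le (by have := hw j; positivity))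

/-- The relation `home` holds between an agent and the pieces where it would like to stay, and
`w i j` is the value of the piece `j` to the agent `i`. In a fair assignment each agent gets
`1 / N` of its total value if its piece is divided proportionally, and only agents who would get
hardly more at home are sent away from home. -/
structure IsFairAssignment [DecidableEq ι] (N : ℕ) (w : κ → ι → ℝ) (home : κ → ι → Prop)
    (σ : κ → ι) : Prop where
  share : ∀ i, (load σ (σ i) : ℝ) * ∑ j, w i j ≤ N * w i (σ i)
  home_or_le : ∀ i j, home i j →
    home i (σ i) ∨ N * w i j ≤ (load σ j + 1) * ∑ k, w i k

lemma exists_isFairAssignment [DecidableEq ι] [Nonempty ι] {N : ℕ}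
    (hN : Fintype.card κ + Fintype.card ι ≤ N + 1) (w : κ → ι → ℝ) (hw : ∀ i j, 0 ≤ w i j)
    (home : κ → ι → Prop) : ∃ σ, IsFairAssignment N w home σ := by
  classical
  choose q hq hfloor using fun i => exists_floor_shares (w i) (hw i) N
  obtain ⟨σ, hσ⟩ := exists_isStable_some (q := q) home fun i => by have := hq i; omega
  have hload (j : ι) : load (fun i => some (σ i)) (some j) = load σ j := by
    simp only [load, Option.some_inj]
  have htotal (i : κ) : 0 ≤ ∑ j, w i j := sum_nonneg fun j _ => hw i j
  refine ⟨σ, fun i => ?_, fun i j hij => or_iff_not_imp_left.2 fun haway => ?_⟩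
  · have hle := hσ.load_le i (σ i) rfl
    rw [hload] at hle
    exact (mul_le_mul_of_nonneg_right (Nat.cast_le.2 hle) (htotal i)).trans (hfloor i _).1
  · have hle := hσ.le_load i (σ i) j rfl (lt_of_le_not_ge (fun h => (haway h).elim) fun h =>
      haway (h hij))
    rw [hload] at hle
    refine (hfloor i j).2.trans (mul_le_mul_of_nonneg_right ?_ (htotal i))
    gcongr

end FairAssignment

section Partition

/-- A half-open box that may be empty. Unlike boxes themselves, such sets are closed under cutting
by a hyperplane orthogonal to an axis. -/
def IsBox {δ : Type*} (S : Set (δ → ℝ)) : Prop :=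
  ∃ W : WithBot (BoxIntegral.Box δ), (W : Set (δ → ℝ)) = S

section IsBox

variable {δ : Type*} {S : Set (δ → ℝ)}

lemma isBox_empty : IsBox (∅ : Set (δ → ℝ)) := ⟨⊥, rfl⟩

lemma isBox_coe (R : BoxIntegral.Box δ) : IsBox (R : Set (δ → ℝ)) := ⟨R, rfl⟩

lemma IsBox.inter_le (hS : IsBox S) (d : δ) (t : ℝ) : IsBox (S ∩ {x | x d ≤ t}) := by
  obtain ⟨W, rfl⟩ := hS
  induction W using WithBot.recBotCoe with
  | bot => simpa using isBox_empty
  | coe R => exact ⟨R.splitLower d t, R.coe_splitLower⟩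

lemma IsBox.inter_gt (hS : IsBox S) (d : δ) (t : ℝ) : IsBox (S ∩ {x | t < x d}) := by
  obtain ⟨W, rfl⟩ := hS
  induction W using WithBot.recBotCoe with
  | bot => simpa using isBox_empty
  | coe R => exact ⟨R.splitUpper d t, R.coe_splitUpper⟩

lemma IsBox.ordConnected (hS : IsBox S) : S.OrdConnected := by
  obtain ⟨W, rfl⟩ := hS
  induction W using WithBot.recBotCoe with
  | bot => exact Set.ordConnected_empty
  | coe R =>
    rw [BoxIntegral.Box.coe_coe, BoxIntegral.Box.coe_eq_pi]
    exact Set.ordConnected_pi fun d _ => Set.ordConnected_Ioc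

lemma exists_isPartition_of_isBox {ι : Type*} [Fintype ι] {C : BoxIntegral.Box δ}
    {S : ι → Set (δ → ℝ)} (hS : ∀ t, IsBox (S t)) (hdisj : Pairwise (Disjoint on S))
    (hunion : ⋃ t, S t = C) :
    ∃ π : BoxIntegral.Prepartition C, π.IsPartition ∧ #π.boxes ≤ Fintype.card ι ∧
      ∀ t, (S t).Nonempty → ∃ J ∈ π.boxes, (J : Set (δ → ℝ)) = S t := by
  classical
  choose W hW using hS
  have hWC (t : ι) : W t ≤ C := by
    rw [← BoxIntegral.Box.withBotCoe_subset_iff, hW, BoxIntegral.Box.coe_coe, ← hunion]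
    exact Set.subset_iUnion S t
  have hWdisj (t t' : ι) (hne : W t ≠ W t') : Disjoint (W t) (W t') := by
    rw [← BoxIntegral.Box.disjoint_withBotCoe, hW, hW]
    exact hdisj (ne_of_apply_ne W hne)
  refine ⟨.ofWithBot (univ.image W) (by simpa using hWC) (by simpa [Set.Pairwise] using hWdisj),
    ?_, (card_eraseNone_le _).trans card_image_le, fun t ht => ?_⟩
  · rw [BoxIntegral.Prepartition.isPartition_iff_iUnion_eq,
      BoxIntegral.Prepartition.iUnion_ofWithBot, ← hunion]
    simp [hW]
  · rw [← hW t] at ht ⊢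
    obtain ⟨J, hJ⟩ := Option.isSome_iff_exists.1 (BoxIntegral.Box.isSome_iff.2 ht)
    refine ⟨J, BoxIntegral.Prepartition.mem_ofWithBot.2 ?_, by rw [hJ]; rfl⟩
    exact mem_image.2 ⟨t, mem_univ t, hJ⟩

end IsBox

section Carve

variable {X ι ρ : Type*} {S : ι → Set X} {A : Set X} {f : X → ρ}

/-- Remove the set `A` from all the sets of a family, and add to the family the parts of `A` on
which `f` is constant. -/
def carve (S : ι → Set X) (A : Set X) (f : X → ρ) : ι ⊕ ρ → Set X :=
  Sum.elim (fun t => S t \ A) fun r => A ∩ f ⁻¹' {r}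

lemma pairwise_disjoint_carve (hS : Pairwise (Disjoint on S)) (A : Set X) (f : X → ρ) :
    Pairwise (Disjoint on carve S A f) := by
  rintro (t | r) (t' | r') hne
  · exact (hS (ne_of_apply_ne Sum.inl hne)).mono Set.sdiff_subset Set.sdiff_subset
  · exact Set.disjoint_sdiff_left.mono_right Set.inter_subset_left
  · exact Set.disjoint_sdiff_right.mono_left Set.inter_subset_left
  · refine Set.disjoint_left.2 fun x hx hx' => hne ?_
    rw [← (hx.2 : f x = r), (hx'.2 : f x = r')]

lemma iUnion_carve (hA : A ⊆ ⋃ t, S t) (f : X → ρ) : ⋃ t, carve S A f t = ⋃ t, S t := by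
  simp only [Set.iUnion_sum, carve, Sum.elim_inl, Sum.elim_inr]
  rw [← Set.iUnion_sdiff, ← Set.inter_iUnion, ← Set.preimage_iUnion, Set.iUnion_of_singleton,
    Set.preimage_univ, Set.inter_univ, Set.sdiff_union_of_subset hA]

end Carve

/-- The state of a sweep of the cake `C` by a line on which the coordinate `0` is `b`, which has met
the rectangles `Z k` with `k ∈ s`: a partition of `C` into boxes `S t`. Each `Z k` that was met
has its own box `S (home k)`, which extends it along the axis `0` only, and every box that reaches
beyond the sweep line ends at the end of the cake. -/
structure IsSweep {κ ι : Type*} (C : Rectangle) (Z : κ → Rectangle) (s : Finset κ) (b : ℝ)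
    (S : ι → Set Plane) (home : κ → ι) : Prop where
  isBox : ∀ t, IsBox (S t)
  pairwise_disjoint : Pairwise (Disjoint on S)
  iUnion_eq : ⋃ t, S t = C
  update_mem : ∀ t, ∀ x ∈ S t, b < x 0 → update x 0 (C.upper 0) ∈ S t
  injOn : Set.InjOn home s
  subset_home : ∀ k ∈ s, (Z k : Set Plane) ⊆ S (home k)
  home_subset : ∀ k ∈ s, ∀ x ∈ S (home k), x 1 ∈ Set.Ioc ((Z k).lower 1) ((Z k).upper 1)

/-- The half-strip that the rectangle `R` sweeps out when it moves along the axis `0`. -/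
def shadow (R : Rectangle) : Set Plane :=
  {x | R.lower 0 < x 0 ∧ x 1 ∈ Set.Ioc (R.lower 1) (R.upper 1)}

/-- The part beyond the sweep line `x 0 = R.lower 0` of the sets `S t` that meet the shadow of `R`.
When the sweep meets `R`, this region is cut off from the sets `S t` and divided anew. -/
def cleared {ι : Type*} (S : ι → Set Plane) (R : Rectangle) : Set Plane :=
  {x | R.lower 0 < x 0 ∧ ∃ t, x ∈ S t ∧ (S t ∩ shadow R).Nonempty}

/-- The three parts into which the plane is divided by the lines through the edges of `R` parallel
to the axis `0`: `0` is the part that contains `R`, `1` the part above and `2` the part below. -/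
noncomputable def slab (R : Rectangle) (x : Plane) : Fin 3 :=
  if R.upper 1 < x 1 then 1 else if x 1 ≤ R.lower 1 then 2 else 0

lemma slab_eq_zero_iff {R : Rectangle} {x : Plane} :
    slab R x = 0 ↔ x 1 ∈ Set.Ioc (R.lower 1) (R.upper 1) := by
  unfold slab
  split_ifs <;> grind

lemma slab_eq_one_iff {R : Rectangle} {x : Plane} : slab R x = 1 ↔ R.upper 1 < x 1 := by
  unfold slab
  split_ifs <;> grind

lemma slab_eq_two_iff {R : Rectangle} {x : Plane} : slab R x = 2 ↔ x 1 ≤ R.lower 1 := by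
  have hR := R.lower_lt_upper 1
  unfold slab
  split_ifs <;> grind

variable {κ ι : Type*} {C R : Rectangle} {Z : κ → Rectangle} {s : Finset κ} {S : ι → Set Plane}
  {home : κ → ι} {b : ℝ} {t t' : ι} {x x' : Plane}

lemma isSweep_empty (C : Rectangle) (Z : κ → Rectangle) (b : ℝ) :
    IsSweep C Z ∅ b (fun _ : Unit => (C : Set Plane)) fun _ => () where
  isBox _ := isBox_coe C
  pairwise_disjoint _ _ hne := (hne rfl).elim
  iUnion_eq := Set.iUnion_const _
  update_mem _ x hx _ := by
    intro d
    rcases eq_or_ne d 0 with rfl | hd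
    · rw [update_self]
      exact C.upper_mem 0
    · rw [update_of_ne hd]
      exact hx d
  injOn := by simp
  subset_home := by simp
  home_subset := by simp

lemma IsSweep.mono (H : IsSweep C Z s b S home) {b' : ℝ} (hb : b ≤ b') :
    IsSweep C Z s b' S home :=
  { H with update_mem := fun t x hx hx0 => H.update_mem t x hx (hb.trans_lt hx0) }

lemma IsSweep.subset (H : IsSweep C Z s b S home) (t : ι) : S t ⊆ C :=
  H.iUnion_eq ▸ Set.subset_iUnion S t

lemma IsSweep.eq_of_mem (H : IsSweep C Z s b S home) (hx : x ∈ S t) (hx' : x ∈ S t') : t = t' :=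
  H.pairwise_disjoint.eq (Set.not_disjoint_iff.2 ⟨x, hx, hx'⟩)

lemma IsSweep.mem_of_crossing (H : IsSweep C Z s b S home) (hx : x ∈ S t) (hxb : b < x 0)
    (hx' : x' ∈ S t) (hxb' : b < x' 0) {y : ℝ} (hy : y ∈ Set.Icc (x 1) (x' 1)) :
    ![C.upper 0, y] ∈ S t := by
  refine (H.isBox t).ordConnected.out (H.update_mem t x hx hxb) (H.update_mem t x' hx' hxb') ?_
  simp only [Set.mem_Icc, Pi.le_def, Fin.forall_fin_two]
  simpa using hy

lemma IsSweep.mem_cleared_iff (H : IsSweep C Z s (R.lower 0) S home) (hx : x ∈ S t) :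
    x ∈ cleared S R ↔ R.lower 0 < x 0 ∧ (S t ∩ shadow R).Nonempty := by
  refine and_congr_right fun _ => ⟨fun ⟨t', hx', ht'⟩ => ?_, fun ht => ⟨t, hx, ht⟩⟩
  rwa [H.eq_of_mem hx hx']

lemma IsSweep.cleared_subset (H : IsSweep C Z s (R.lower 0) S home) :
    cleared S R ⊆ C := fun _ ⟨_, t, hx, _⟩ => H.subset t hx

lemma IsSweep.isBox_diff_cleared (H : IsSweep C Z s (R.lower 0) S home) (t : ι) :
    IsBox (S t \ cleared S R) := by
  by_cases ht : (S t ∩ shadow R).Nonempty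
  · convert (H.isBox t).inter_le 0 (R.lower 0) using 1
    ext x
    exact and_congr_right fun hx => by simp [H.mem_cleared_iff hx, ht]
  · convert H.isBox t using 1
    exact sdiff_eq_left.2 <| Set.disjoint_left.2 fun x hx hx' =>
      ht ((H.mem_cleared_iff hx).1 hx').2

lemma IsSweep.isBox_cleared_inter (H : IsSweep C Z s (R.lower 0) S home)
    {D : Set Plane} (hD : ∀ S : Set Plane, IsBox S → IsBox (S ∩ D))
    {p : Plane} (hp : ∀ t, ∀ x ∈ S t, ∀ x' ∈ S t, x ∈ shadow R → R.lower 0 < x' 0 → x' ∈ D →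
      p ∈ S t) : IsBox (cleared S R ∩ D) := by
  rcases (cleared S R ∩ D).eq_empty_or_nonempty with hempty | ⟨x, ⟨hx0, t, hxt, ht⟩, hxD⟩
  · exact hempty ▸ isBox_empty
  -- Every `S t` that contributes to the intersection contains `p`, so only one of them does.
  convert hD _ ((H.isBox t).inter_gt 0 (R.lower 0)) using 1
  ext x'
  refine and_congr_left fun hxD' => ⟨fun ⟨hx0', t', hxt', ht'⟩ => ?_, fun ⟨hxt', hx0'⟩ =>
    ⟨hx0', t, hxt', ht⟩⟩
  obtain ⟨y, hy, hyR⟩ := ht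
  obtain ⟨y', hy', hyR'⟩ := ht'
  obtain rfl := H.eq_of_mem (hp t y hy x hxt hyR hx0 hxD) (hp t' y' hy' x' hxt' hyR' hx0' hxD')
  exact ⟨hxt', hx0'⟩

lemma IsSweep.isBox_cleared_inter_slab (H : IsSweep C Z s (R.lower 0) S home) (r : Fin 3) :
    IsBox (cleared S R ∩ slab R ⁻¹' {r}) := by
  fin_cases r <;> simp only [Set.preimage, Set.mem_singleton_iff, Fin.zero_eta, Fin.mk_one,
    Fin.reduceFinMk, slab_eq_zero_iff, slab_eq_one_iff, slab_eq_two_iff]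
  · convert (((isBox_coe C).inter_gt 0 (R.lower 0)).inter_gt 1 (R.lower 1)).inter_le 1 (R.upper 1)
      using 1
    ext x
    refine ⟨fun ⟨hx, hxR⟩ => ⟨⟨⟨H.cleared_subset hx, hx.1⟩, hxR.1⟩, hxR.2⟩,
      fun ⟨⟨⟨hx, hx0⟩, hlower⟩, hupper⟩ => ⟨⟨hx0, ?_⟩, hlower, hupper⟩⟩
    rw [← H.iUnion_eq, Set.mem_iUnion] at hx
    obtain ⟨t, hxt⟩ := hx
    exact ⟨t, hxt, x, hxt, hx0, hlower, hupper⟩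
  · exact H.isBox_cleared_inter (fun S hS => hS.inter_gt 1 _) fun t x hx x' hx' hxR hx0' hD =>
      H.mem_of_crossing hx hxR.1 hx' hx0' ⟨hxR.2.2, hD.le⟩
  · exact H.isBox_cleared_inter (fun S hS => hS.inter_le 1 _) fun t x hx x' hx' hxR hx0' hD =>
      H.mem_of_crossing hx' hx0' hx hxR.1 ⟨hD, hxR.2.1.le⟩

lemma IsSweep.update_mem_carve (H : IsSweep C Z s (R.lower 0) S home) (t : ι ⊕ Fin 3)
    (hx : x ∈ carve S (cleared S R) (slab R) t) (hx0 : R.lower 0 < x 0) :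
    update x 0 (C.upper 0) ∈ carve S (cleared S R) (slab R) t := by
  rcases t with t | r
  · have hmem := H.update_mem t x hx.1 hx0
    refine ⟨hmem, fun hcleared => hx.2 ?_⟩
    exact (H.mem_cleared_iff hx.1).2 ⟨hx0, ((H.mem_cleared_iff hmem).1 hcleared).2⟩
  · obtain ⟨⟨-, t, hxt, ht⟩, hr⟩ := hx
    refine ⟨⟨?_, t, H.update_mem t x hxt hx0, ht⟩, ?_⟩
    · rw [update_self]
      exact hx0.trans_le ((H.subset t hxt) 0).2
    · simpa [slab] using hr

lemma IsSweep.disjoint_cleared (H : IsSweep C Z s (R.lower 0) S home) {k : κ} (hk : k ∈ s)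
    (hkR : Disjoint (Z k : Set Plane) R) (hle : (Z k).lower 0 ≤ R.lower 0) :
    Disjoint (Z k : Set Plane) (cleared S R) := by
  refine Set.disjoint_left.2 fun x hx hxR => ?_
  obtain ⟨hx0, y, hy, -, hyR⟩ := (H.mem_cleared_iff (H.subset_home k hk hx)).1 hxR
  have hyZ := H.home_subset k hk y hy
  have hZ : R.lower 0 < (Z k).upper 0 := hx0.trans_le (hx 0).2
  refine hkR.notMem_of_mem_left (a := ![min ((Z k).upper 0) (R.upper 0), y 1]) ?_ ?_ <;>
    rw [BoxIntegral.Box.mem_coe, BoxIntegral.Box.mem_def, Fin.forall_fin_two]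
  · exact ⟨⟨lt_min ((Z k).lower_lt_upper 0) (hle.trans_lt (R.lower_lt_upper 0)), min_le_left _ _⟩,
      hyZ⟩
  · exact ⟨⟨lt_min hZ (R.lower_lt_upper 0), min_le_right _ _⟩, hyR⟩

lemma IsSweep.insert [DecidableEq κ] {j : κ} (H : IsSweep C Z s ((Z j).lower 0) S home)
    (hsub : (Z j : Set Plane) ⊆ C) (hj : j ∉ s)
    (hdisj : ∀ k ∈ s, Disjoint (Z k : Set Plane) (Z j : Set Plane))
    (hle : ∀ k ∈ s, (Z k).lower 0 ≤ (Z j).lower 0) :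
    IsSweep C Z (insert j s) ((Z j).lower 0) (carve S (cleared S (Z j)) (slab (Z j)))
      (update (Sum.inl ∘ home) j (Sum.inr 0)) := by
  have hhome : ∀ k ∈ s, update (Sum.inl ∘ home) j (Sum.inr (0 : Fin 3)) k = Sum.inl (home k) :=
    fun k hk => update_of_ne (ne_of_mem_of_not_mem hk hj) _ _
  refine ⟨?_, pairwise_disjoint_carve H.pairwise_disjoint _ _, ?_,
    fun t x => H.update_mem_carve t, ?_, ?_, ?_⟩
  · rintro (t | r)
    exacts [H.isBox_diff_cleared t, H.isBox_cleared_inter_slab r]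
  · rw [iUnion_carve (H.iUnion_eq ▸ H.cleared_subset), H.iUnion_eq]
  · rw [coe_insert, Set.injOn_insert (by exact_mod_cast hj)]
    refine ⟨fun k hk l hl hkl => H.injOn hk hl ?_, ?_⟩
    · rw [hhome k hk, hhome l hl] at hkl
      exact Sum.inl_injective hkl
    · rintro ⟨k, hk, hkj⟩
      rw [hhome k hk, update_self] at hkj
      exact Sum.inl_ne_inr hkj
  · refine forall_mem_insert _ _ _ |>.2 ⟨?_, fun k hk => ?_⟩
    · rw [update_self]
      intro x hx
      obtain ⟨t, hxt⟩ := Set.mem_iUnion.1 (H.iUnion_eq ▸ hsub hx)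
      exact ⟨⟨(hx 0).1, t, hxt, x, hxt, (hx 0).1, hx 1⟩, slab_eq_zero_iff.2 (hx 1)⟩
    · rw [hhome k hk]
      exact Set.subset_sdiff.2 ⟨H.subset_home k hk, H.disjoint_cleared hk (hdisj k hk) (hle k hk)⟩
  · refine forall_mem_insert _ _ _ |>.2 ⟨fun x hx => ?_, fun k hk x hx => ?_⟩
    · rw [update_self] at hx
      exact slab_eq_zero_iff.1 hx.2
    · rw [hhome k hk] at hx
      exact H.home_subset k hk x hx.1

lemma exists_isSweep (hsub : ∀ j, (Z j : Set Plane) ⊆ C)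
    (hdisj : Pairwise (Disjoint on fun j => (Z j : Set Plane))) (s : Finset κ) :
    ∀ b, (∀ k ∈ s, (Z k).lower 0 ≤ b) → ∃ (ι : Type) (_ : Fintype ι) (S : ι → Set Plane)
      (home : κ → ι), Fintype.card ι ≤ 3 * #s + 1 ∧ IsSweep C Z s b S home := by
  classical
  induction s using induction_on_max_value (fun j => (Z j).lower 0) with
  | empty => exact fun b _ => ⟨Unit, inferInstance, _, _, by simp, isSweep_empty C Z b⟩
  | insert j s hj hle ih =>
    intro b hb
    obtain ⟨ι, _, S, home, hcard, H⟩ := ih _ hle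
    refine ⟨ι ⊕ Fin 3, inferInstance, _, _, ?_, (H.insert (hsub j) hj (fun k hk =>
      hdisj (ne_of_mem_of_not_mem hk hj)) hle).mono (hb j (mem_insert_self j s))⟩
    rw [card_insert_of_notMem hj, Fintype.card_sum, Fintype.card_fin]
    omega

lemma exists_isPartition_of_pairwise_disjoint [Fintype κ] (hsub : ∀ j, (Z j : Set Plane) ⊆ C)
    (hdisj : Pairwise (Disjoint on fun j => (Z j : Set Plane))) :
    ∃ π : BoxIntegral.Prepartition C, π.IsPartition ∧ #π.boxes ≤ 3 * Fintype.card κ + 1 ∧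
      ∃ home : κ → π.boxes, Injective home ∧ ∀ j, Z j ≤ home j := by
  classical
  obtain ⟨b, hb⟩ := (Set.finite_range fun j => (Z j).lower 0).bddAbove
  obtain ⟨ι, _, S, home, hcard, H⟩ :=
    exists_isSweep hsub hdisj univ b fun k _ => hb (Set.mem_range_self k)
  obtain ⟨π, hπ, hπcard, hbox⟩ :=
    exists_isPartition_of_isBox H.isBox H.pairwise_disjoint H.iUnion_eq
  have hZS (j : κ) : (Z j : Set Plane) ⊆ S (home j) := H.subset_home j (mem_univ j)
  choose J hJπ hJ using fun j => hbox (home j) ⟨_, hZS j (Z j).upper_mem⟩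
  refine ⟨π, hπ, hπcard.trans hcard, fun j => ⟨J j, hJπ j⟩, fun j k hjk => ?_, fun j => ?_⟩
  · have hJk : J j = J k := congrArg Subtype.val hjk
    have hmem : (Z j).upper ∈ S (home k) := by
      rw [← hJ, ← hJk, hJ]
      exact hZS j (Z j).upper_mem
    exact H.injOn (mem_coe.2 (mem_univ j)) (mem_coe.2 (mem_univ k))
      (H.eq_of_mem (hZS j (Z j).upper_mem) hmem)
  · exact BoxIntegral.Box.coe_subset_coe.1 (hJ j ▸ hZS j)

end Partition

section Value

/-- A value-density on the cake `C` that may be unbounded. -/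
structure IsNonnegDensity (C : Rectangle) (v : Plane → ℝ) : Prop where
  integrableOn : IntegrableOn v (C : Set Plane)
  nonneg : ∀ x ∈ C, 0 ≤ v x

variable {C R : Rectangle} {v : Plane → ℝ} {A B : Set Plane} {d : Fin 2} {s t c : ℝ}

lemma IsValueDensity.isNonnegDensity (hv : IsValueDensity C v) : IsNonnegDensity C v :=
  ⟨hv.integrableOn, hv.nonneg⟩

lemma IsNonnegDensity.value_nonneg (hv : IsNonnegDensity C v) (hA : A ⊆ C)
    (hm : MeasurableSet A) : 0 ≤ value v A :=
  setIntegral_nonneg hm fun x hx => hv.nonneg x (hA hx)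

lemma IsNonnegDensity.value_mono (hv : IsNonnegDensity C v) (hAB : A ⊆ B) (hB : B ⊆ C)
    (hm : MeasurableSet B) : value v A ≤ value v B :=
  setIntegral_mono_set (hv.integrableOn.mono_set hB)
    ((ae_restrict_iff' hm).2 (.of_forall fun x hx => hv.nonneg x (hB hx))) hAB.eventuallyLE

lemma value_eq_sum {π : BoxIntegral.Prepartition C} (hπ : π.IsPartition)
    (hv : IntegrableOn v (C : Set Plane)) : value v C = ∑ J : π.boxes, value v J.1 := by
  rw [sum_coe_sort π.boxes fun J => value v J, ← hπ.iUnion_eq, BoxIntegral.Prepartition.iUnion_def']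
  exact integral_biUnion_finset _ (fun J _ => J.measurableSet_coe) π.pairwiseDisjoint
    fun J hJ => hv.mono_set (π.le_of_mem hJ)

lemma lowerPart_subset (R : Rectangle) (d : Fin 2) (t : ℝ) : lowerPart R d t ⊆ R :=
  fun _ hx => hx.1

lemma lowerPart_mono (R : Rectangle) (d : Fin 2) (hst : s ≤ t) :
    lowerPart R d s ⊆ lowerPart R d t :=
  fun _ hx => ⟨hx.1, hx.2.trans hst⟩

lemma lowerPart_lower (R : Rectangle) (d : Fin 2) : lowerPart R d (R.lower d) = ∅ :=
  Set.eq_empty_of_forall_notMem fun _ hx => (hx.1 d).1.not_ge hx.2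

lemma lowerPart_upper (R : Rectangle) (d : Fin 2) : lowerPart R d (R.upper d) = R :=
  Set.Subset.antisymm (lowerPart_subset R d _) fun _ hx => ⟨hx, (hx d).2⟩

lemma measurableSet_lowerPart (R : Rectangle) (d : Fin 2) (t : ℝ) :
    MeasurableSet (lowerPart R d t) :=
  R.measurableSet_coe.inter (measurableSet_le (measurable_pi_apply d) measurable_const)

lemma mem_Ioo_of_value_lowerPart_eq (hR : 0 < value v R) (hc : c ∈ Set.Ioo 0 1)
    (ht : t ∈ Set.Icc (R.lower d) (R.upper d)) (h : value v (lowerPart R d t) = c * value v R) :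
    t ∈ Set.Ioo (R.lower d) (R.upper d) := by
  refine ⟨ht.1.lt_of_ne ?_, ht.2.lt_of_ne ?_⟩ <;> rintro rfl
  · rw [lowerPart_lower, value, setIntegral_empty] at h
    exact (mul_pos hc.1 hR).ne h
  · rw [lowerPart_upper] at h
    exact (mul_lt_of_lt_one_left hR hc.2).ne' h

lemma exists_split (ht : t ∈ Set.Ioo (R.lower d) (R.upper d)) :
    ∃ A B : Rectangle, (A : Set Plane) = lowerPart R d t ∧
      (B : Set Plane) = (R : Set Plane) \ lowerPart R d t := by
  obtain ⟨A, hA⟩ := WithBot.ne_bot_iff_exists.1 <|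
    mt BoxIntegral.Box.splitLower_eq_bot.1 ht.1.not_ge
  obtain ⟨B, hB⟩ := WithBot.ne_bot_iff_exists.1 <|
    mt BoxIntegral.Box.splitUpper_eq_bot.1 ht.2.not_ge
  refine ⟨A, B, ?_, ?_⟩
  · rw [← BoxIntegral.Box.coe_coe, hA, BoxIntegral.Box.coe_splitLower]
    rfl
  · rw [← BoxIntegral.Box.coe_coe, hB, BoxIntegral.Box.coe_splitUpper]
    ext x
    refine and_congr_right fun hx => ?_
    have hxR : x ∈ R := hx
    simp [lowerPart, hxR]

end Value

section Solvable

variable {n : ℕ} {α β : Type} {C : Rectangle}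

/-- Run a protocol and continue with a protocol that depends on its output. -/
def Protocol.bind : Protocol n α → (α → Protocol n β) → Protocol n β
  | .done a, f => f a
  | .eval i R next, f => .eval i R fun r => (next r).bind f
  | .mark i R d a next, f => .mark i R d a fun r => (next r).bind f

lemma Protocol.Achieves.mono {v : Fin n → Plane → ℝ} {Good Good' : β → Prop} {P : Protocol n β}
    (hGood : ∀ b, Good b → Good' b) :
    ∀ {q q' : ℕ}, q ≤ q' → P.Achieves C v Good q → P.Achieves C v Good' q' := by
  induction P with
  | done b => exact fun _ h => hGood b h
  | eval i R next ih =>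
    rintro (_ | q) (_ | q') hq h
    · exact h
    · exact h.elim
    · simp at hq
    · exact ⟨h.1, ih _ (Nat.le_of_succ_le_succ hq) h.2⟩
  | mark i R d a next ih =>
    rintro (_ | q) (_ | q') hq h
    · exact h
    · exact h.elim
    · simp at hq
    · exact ⟨h.1, h.2.1, h.2.2.1, fun t ht hta =>
        ih _ (Nat.le_of_succ_le_succ hq) (h.2.2.2 t ht hta)⟩

lemma Protocol.Achieves.bind {v : Fin n → Plane → ℝ} {Good : β → Prop} {P : Protocol n α}
    {f : α → Protocol n β} {p : ℕ} :
    ∀ {q : ℕ}, P.Achieves C v (fun a => (f a).Achieves C v Good p) q →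
      (P.bind f).Achieves C v Good (q + p) := by
  induction P with
  | done a => exact fun h => Achieves.mono (fun _ => id) (Nat.le_add_left _ _) h
  | eval i R next ih =>
    rintro (_ | q) h
    · exact h.elim
    · rw [Nat.add_right_comm]
      exact ⟨h.1, ih _ h.2⟩
  | mark i R d a next ih =>
    rintro (_ | q) h
    · exact h.elim
    · rw [Nat.add_right_comm]
      exact ⟨h.1, h.2.1, h.2.2.1, fun t ht hta => ih _ (h.2.2.2 t ht hta)⟩

/-- Some protocol achieves the postcondition `Post` with at most `q` queries, whichever of the
profiles of value-densities in `𝒱` is the true one. When protocols are composed, `𝒱` shrinks to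
the profiles that are still possible after the answers received. -/
def Solvable (C : Rectangle) (𝒱 : Set (Fin n → Plane → ℝ))
    (Post : (Fin n → Plane → ℝ) → β → Prop) (q : ℕ) : Prop :=
  ∃ P : Protocol n β, ∀ v ∈ 𝒱, P.Achieves C v (Post v) q

variable {𝒱 𝒱' : Set (Fin n → Plane → ℝ)} {Post Post' : (Fin n → Plane → ℝ) → β → Prop}
  {p q q' : ℕ}

lemma Solvable.pure (b : β) (h : ∀ v ∈ 𝒱, Post v b) : Solvable C 𝒱 Post q :=
  ⟨.done b, h⟩

lemma Solvable.mono (h : Solvable C 𝒱 Post q) (h𝒱 : 𝒱' ⊆ 𝒱)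
    (hPost : ∀ v ∈ 𝒱', ∀ b, Post v b → Post' v b) (hq : q ≤ q') : Solvable C 𝒱' Post' q' :=
  let ⟨P, hP⟩ := h
  ⟨P, fun v hv => (hP v (h𝒱 hv)).mono (hPost v hv) hq⟩

lemma Solvable.bind {Mid : (Fin n → Plane → ℝ) → α → Prop} (h : Solvable C 𝒱 Mid q)
    (h' : ∀ a, Solvable C {v ∈ 𝒱 | Mid v a} Post p) : Solvable C 𝒱 Post (q + p) := by
  obtain ⟨P, hP⟩ := h
  choose f hf using h'
  exact ⟨P.bind f, fun v hv => .bind ((hP v hv).mono (fun a ha => hf a v ⟨hv, ha⟩) le_rfl)⟩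

lemma Solvable.of_nonempty [Nonempty β] (h : 𝒱.Nonempty → Solvable C 𝒱 Post q) :
    Solvable C 𝒱 Post q := by
  rcases 𝒱.eq_empty_or_nonempty with rfl | h𝒱
  · exact .pure (Classical.arbitrary β) fun _ hv => hv.elim
  · exact h h𝒱

lemma Solvable.forall_mem {κ : Type} [Nonempty β] {s : Finset κ}
    {Post : κ → (Fin n → Plane → ℝ) → β → Prop} {q : κ → ℕ}
    (h : ∀ k ∈ s, Solvable C 𝒱 (Post k) (q k)) :
    Solvable C 𝒱 (fun v (f : κ → β) => ∀ k ∈ s, Post k v (f k)) (∑ k ∈ s, q k) := by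
  classical
  induction s using Finset.induction_on with
  | empty => exact .pure (Classical.arbitrary _) (by simp)
  | insert a s ha ih =>
    rw [forall_mem_insert] at h
    rw [sum_insert ha]
    refine h.1.bind fun b => ?_
    refine (((ih h.2).mono (Set.sep_subset _ _) (fun _ _ _ hf => hf) le_rfl).bind (p := 0)
      fun f => .pure (update f a b) fun v hv => ?_)
    refine forall_mem_insert _ _ _ |>.2 ⟨?_, fun k hk => ?_⟩
    · rw [update_self]
      exact hv.1.2
    · rw [update_of_ne (ne_of_mem_of_not_mem hk ha)]
      exact hv.2 k hk

lemma Solvable.eval (i : Fin n) {R : Rectangle} (hR : (R : Set Plane) ⊆ C) :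
    Solvable C 𝒱 (fun v r => r = value (v i) R) 1 :=
  ⟨.eval i R .done, fun _ _ => ⟨hR, rfl⟩⟩

lemma Solvable.cut {i : Fin n} (h𝒱 : ∀ v ∈ 𝒱, IsNonnegDensity C (v i)) {R : Rectangle}
    (hR : (R : Set Plane) ⊆ C) (d : Fin 2) {c : ℝ} (hc : c ∈ Set.Ioo 0 1) :
    Solvable C 𝒱 (fun v t => t ∈ Set.Ioo (R.lower d) (R.upper d) ∧
      value (v i) (lowerPart R d t) = c * value (v i) R) 2 := by
  refine (Solvable.eval i hR).bind (p := 1) fun r => ?_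
  rcases lt_or_ge 0 r with hr | hr
  · refine ⟨.mark i R d (c * r) .done, ?_⟩
    rintro v ⟨-, rfl⟩
    exact ⟨hR, (mul_pos hc.1 hr).le, mul_le_of_le_one_left hr.le hc.2.le, fun t ht h =>
      ⟨mem_Ioo_of_value_lowerPart_eq hr hc ht h, h⟩⟩
  · obtain ⟨t, ht⟩ := Set.nonempty_Ioo.2 (R.lower_lt_upper d)
    refine .pure t ?_
    rintro v ⟨hv, rfl⟩
    have hzero : value (v i) R = 0 := hr.antisymm ((h𝒱 v hv).value_nonneg hR R.measurableSet_coe)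
    refine ⟨ht, ?_⟩
    rw [hzero, mul_zero]
    refine le_antisymm (hzero ▸ (h𝒱 v hv).value_mono (lowerPart_subset R d t) hR
      R.measurableSet_coe) ?_
    exact (h𝒱 v hv).value_nonneg ((lowerPart_subset R d t).trans hR) (measurableSet_lowerPart R d t)

end Solvable

section Division

lemma exists_subset_card_eq_forall_le {κ α : Type*} [DecidableEq κ] [LinearOrder α] (f : κ → α)
    (s : Finset κ) {k : ℕ} (hk : k ≤ #s) :
    ∃ t ⊆ s, #t = k ∧ ∀ i ∈ t, ∀ j ∈ s \ t, f i ≤ f j := by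
  induction k with
  | zero => exact ⟨∅, by simp⟩
  | succ k ih =>
    obtain ⟨t, hts, ht, hle⟩ := ih (Nat.le_of_succ_le hk)
    have hne : (s \ t).Nonempty := by
      rw [← card_pos, card_sdiff_of_subset hts]
      omega
    obtain ⟨x, hx, hmin⟩ := exists_min_image _ f hne
    obtain ⟨hxs, hxt⟩ := mem_sdiff.1 hx
    refine ⟨insert x t, insert_subset hxs hts, by rw [card_insert_of_notMem hxt, ht], ?_⟩
    have hsub : s \ insert x t ⊆ s \ t := sdiff_subset_sdiff le_rfl (subset_insert x t)
    exact forall_mem_insert _ _ _ |>.2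
      ⟨fun j hj => hmin j (hsub hj), fun i hi j hj => hle i hi j (hsub hj)⟩

variable {n : ℕ} {C R A B : Rectangle} {G G' : Finset (Fin n)} {v : Fin n → Plane → ℝ}
  {X Y : Fin n → Rectangle}

/-- The rectangles `X i` with `i ∈ G` form a proportional division of `R` among the agents in `G`;
the other rectangles `X i` are irrelevant. -/
structure IsDivision (R : Rectangle) (G : Finset (Fin n)) (v : Fin n → Plane → ℝ)
    (X : Fin n → Rectangle) : Prop where
  subset : ∀ i ∈ G, (X i : Set Plane) ⊆ R
  disjoint : ∀ i ∈ G, ∀ j ∈ G, i ≠ j → Disjoint (X i : Set Plane) (X j : Set Plane)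
  proportional : ∀ i ∈ G, value (v i) R ≤ #G * value (v i) (X i)

lemma IsDivision.of_card_le_one (R : Rectangle) (hG : #G ≤ 1) (v : Fin n → Plane → ℝ) :
    IsDivision R G v fun _ => R where
  subset _ _ := subset_rfl
  disjoint i hi j hj hij := (hij (card_le_one.1 hG i hi j hj)).elim
  proportional i hi := by
    have hcard : #G = 1 := hG.antisymm (card_pos.2 ⟨i, hi⟩)
    simp [hcard]

lemma IsDivision.value_le_of_card_mul_le (hX : IsDivision A G' v X) {i : Fin n} (hi : i ∈ G')
    (hA : #G' * value (v i) R ≤ #G * value (v i) A) :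
    value (v i) R ≤ #G * value (v i) (X i) := by
  have hpos : (0 : ℝ) < #G' := Nat.cast_pos.2 (card_pos.2 ⟨i, hi⟩)
  refine le_of_mul_le_mul_left ?_ hpos
  calc #G' * value (v i) R ≤ #G * value (v i) A := hA
    _ ≤ #G * (#G' * value (v i) (X i)) := by
      gcongr
      exact hX.proportional i hi
    _ = #G' * (#G * value (v i) (X i)) := mul_left_comm ..

lemma IsDivision.piecewise (hX : IsDivision A G' v X) (hY : IsDivision B (G \ G') v Y)
    (hAR : (A : Set Plane) ⊆ R) (hBR : (B : Set Plane) ⊆ R)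
    (hAB : Disjoint (A : Set Plane) (B : Set Plane))
    (hA : ∀ i ∈ G', #G' * value (v i) R ≤ #G * value (v i) A)
    (hB : ∀ i ∈ G \ G', #(G \ G') * value (v i) R ≤ #G * value (v i) B) :
    IsDivision R G v (G'.piecewise X Y) := by
  have hdiff {i : Fin n} (hi : i ∈ G) (hi' : i ∉ G') : i ∈ G \ G' := mem_sdiff.2 ⟨hi, hi'⟩
  refine ⟨fun i hi => ?_, fun i hi j hj hij => ?_, fun i hi => ?_⟩
  · by_cases hi' : i ∈ G' <;> simp only [hi', piecewise_eq_of_mem, piecewise_eq_of_notMem,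
      not_false_eq_true]
    · exact (hX.subset i hi').trans hAR
    · exact (hY.subset i (hdiff hi hi')).trans hBR
  · by_cases hi' : i ∈ G' <;> by_cases hj' : j ∈ G' <;> simp only [hi', hj', piecewise_eq_of_mem,
      piecewise_eq_of_notMem, not_false_eq_true]
    · exact hX.disjoint i hi' j hj' hij
    · exact hAB.mono (hX.subset i hi') (hY.subset j (hdiff hj hj'))
    · exact hAB.symm.mono (hY.subset i (hdiff hi hi')) (hX.subset j hj')
    · exact hY.disjoint i (hdiff hi hi') j (hdiff hj hj') hij
  · by_cases hi' : i ∈ G' <;> simp only [hi', piecewise_eq_of_mem, piecewise_eq_of_notMem,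
      not_false_eq_true]
    · exact hX.value_le_of_card_mul_le hi' (hA i hi')
    · exact hY.value_le_of_card_mul_le (hdiff hi hi') (hB i (hdiff hi hi'))

lemma IsNonnegDensity.mul_le_value_lowerPart {v : Plane → ℝ} (hv : IsNonnegDensity C v)
    (hR : (R : Set Plane) ⊆ C) {d : Fin 2} {s t c : ℝ} (hst : s ≤ t)
    (hs : value v (lowerPart R d s) = c * value v R) :
    c * value v R ≤ value v (lowerPart R d t) :=
  hs ▸ hv.value_mono (lowerPart_mono R d hst) ((lowerPart_subset R d t).trans hR)
    (measurableSet_lowerPart R d t)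

lemma IsNonnegDensity.mul_le_value_diff_lowerPart {v : Plane → ℝ} (hv : IsNonnegDensity C v)
    (hR : (R : Set Plane) ⊆ C) {d : Fin 2} {s t c : ℝ} (hts : t ≤ s)
    (hs : value v (lowerPart R d s) = c * value v R) :
    (1 - c) * value v R ≤ value v ((R : Set Plane) \ lowerPart R d t) := by
  have hle : value v (lowerPart R d t) ≤ value v (lowerPart R d s) :=
    hv.value_mono (lowerPart_mono R d hts) ((lowerPart_subset R d s).trans hR)
      (measurableSet_lowerPart R d s)
  have hdiff : value v ((R : Set Plane) \ lowerPart R d t) =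
      value v R - value v (lowerPart R d t) :=
    setIntegral_sdiff (measurableSet_lowerPart R d t) (hv.integrableOn.mono_set hR)
      (lowerPart_subset R d t)
  linarith

lemma exists_split_of_cuts (hR : (R : Set Plane) ⊆ C) {d : Fin 2} {f : Fin n → ℝ} {k : ℕ}
    (hk : 0 < k) (hkG : k < #G) (hf : ∀ i ∈ G, f i ∈ Set.Ioo (R.lower d) (R.upper d)) :
    ∃ G' ⊆ G, #G' = k ∧ ∃ A B : Rectangle, (A : Set Plane) ⊆ R ∧ (B : Set Plane) ⊆ R ∧
      ∀ v : Fin n → Plane → ℝ, (∀ i, IsNonnegDensity C (v i)) →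
        (∀ i ∈ G, value (v i) (lowerPart R d (f i)) = k / #G * value (v i) R) →
        ∀ X Y, IsDivision A G' v X → IsDivision B (G \ G') v Y →
          IsDivision R G v (G'.piecewise X Y) := by
  obtain ⟨G', hG', hcard, hle⟩ := exists_subset_card_eq_forall_le f G hkG.le
  obtain ⟨x, hx, hmax⟩ := exists_max_image G' f (card_pos.1 (hcard ▸ hk))
  obtain ⟨A, B, hA, hB⟩ := exists_split (hf x (hG' hx))
  have hAR : (A : Set Plane) ⊆ R := hA ▸ lowerPart_subset R d _
  have hBR : (B : Set Plane) ⊆ R := hB ▸ Set.sdiff_subset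
  have hAB : Disjoint (A : Set Plane) (B : Set Plane) := by
    rw [hA, hB]
    exact Set.disjoint_sdiff_right
  have hpos : (0 : ℝ) < #G := Nat.cast_pos.2 (hk.trans hkG)
  refine ⟨G', hG', hcard, A, B, hAR, hBR, fun v hv hcut X Y hX hY =>
    hX.piecewise hY hAR hBR hAB (fun i hi => ?_) fun i hi => ?_⟩
  · have hshare := (hv i).mul_le_value_lowerPart hR (hmax i hi) (hcut i (hG' hi))
    rwa [← hA, div_mul_eq_mul_div, div_le_iff₀' hpos, ← hcard] at hshare
  · have hshare := (hv i).mul_le_value_diff_lowerPart hR (hle x hx i hi)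
      (hcut i (mem_sdiff.1 hi).1)
    rwa [← hB, one_sub_div hpos.ne', div_mul_eq_mul_div, div_le_iff₀' hpos, ← Nat.cast_sub hkG.le,
      ← hcard, ← card_sdiff_of_subset hG'] at hshare

instance : Nonempty Rectangle := ⟨⟨0, 1, fun _ => zero_lt_one⟩⟩

lemma solvable_isDivision (h : ℕ) {𝒱 : Set (Fin n → Plane → ℝ)}
    (h𝒱 : ∀ v ∈ 𝒱, ∀ i, IsNonnegDensity C (v i)) (hR : (R : Set Plane) ⊆ C) (hG : #G ≤ 2 ^ h) :
    Solvable C 𝒱 (fun v X => IsDivision R G v X) (2 * #G * h) := by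
  induction h generalizing 𝒱 R G with
  | zero => exact .pure (fun _ => R) fun v _ => .of_card_le_one R (by simpa using hG) v
  | succ h ih =>
    rcases Nat.lt_or_ge 1 #G with hone | hone
    swap
    · exact .pure (fun _ => R) fun v _ => .of_card_le_one R hone v
    have hk : 0 < #G / 2 := by omega
    have hkG : #G / 2 < #G := by omega
    have hc : ((#G / 2 : ℕ) / #G : ℝ) ∈ Set.Ioo 0 1 :=
      ⟨by positivity, (div_lt_one (by positivity)).2 (Nat.cast_lt.2 hkG)⟩
    have hcuts := Solvable.forall_mem (s := G) fun i _ =>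
      Solvable.cut (fun v hv => h𝒱 v hv i) hR 0 hc
    rw [sum_const, smul_eq_mul] at hcuts
    have hcost : 2 * #G * (h + 1) = #G * 2 + 2 * #G * h := by ring
    rw [hcost]
    refine hcuts.bind fun f => .of_nonempty fun ⟨v, hv⟩ => ?_
    obtain ⟨G', hG', hcard, A, B, hAR, hBR, hdivision⟩ :=
      exists_split_of_cuts hR hk hkG fun i hi => (hv.2 i hi).1
    have hcard' : #(G \ G') = #G - #G / 2 := by rw [card_sdiff_of_subset hG', hcard]
    have hsum : 2 * #G * h = 2 * #G' * h + 2 * #(G \ G') * h := by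
      rw [← add_mul, ← mul_add, add_comm #G', card_sdiff_add_card_eq_card hG']
    rw [hsum]
    refine (ih (fun v hv => h𝒱 v hv.1) (hAR.trans hR) (by omega)).bind fun X => ?_
    refine (ih (fun v hv => h𝒱 v hv.1.1) (hBR.trans hR) (by omega)).bind (p := 0) fun Y => ?_
    exact .pure (G'.piecewise X Y) fun v hv =>
      hdivision v (h𝒱 v hv.1.1.1) (fun i hi => (hv.1.1.2 i hi).2) X Y hv.1.2 hv.2

end Division

section Redivision

lemma card_filter_le_of_sum_le {κ : Type*} [Fintype κ] {N : κ → ℕ} {c k : ℕ} (hc : 0 < c)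
    (hN : ∑ j, N j ≤ c * k) : #{j | c ≤ N j} ≤ k := by
  refine Nat.le_of_mul_le_mul_left ?_ hc
  calc c * #{j | c ≤ N j} ≤ ∑ j with c ≤ N j, N j := by
        rw [mul_comm, ← smul_eq_mul]
        exact card_nsmul_le_sum _ _ _ fun j hj => (mem_filter.1 hj).2
    _ ≤ ∑ j, N j := sum_le_sum_of_subset (filter_subset _ _)
    _ ≤ c * k := hN

variable {m n : ℕ} {hmn : m ≤ n} {C : Rectangle} {v : Fin n → Plane → ℝ} {Z : Fin m → Rectangle}
  {X : Fin n → Rectangle}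

lemma gradualRetention_of_sum_le {N : Fin m → ℕ} (hN : ∑ j, N j ≤ n)
    (hX : ∀ i, 0 ≤ value (v i) (X i))
    (h : ∀ j, value (v (Fin.castLE hmn j)) (Z j) ≤
      (N j + 1) * value (v (Fin.castLE hmn j)) (X (Fin.castLE hmn j))) :
    GradualRetention hmn v Z X := by
  intro k hk hkm
  have hkpos : (0 : ℝ) < k := Nat.cast_pos.2 hk
  have hnpos : (0 : ℝ) < n := Nat.cast_pos.2 (hk.trans (hkm.trans hmn))
  set c := ⌈(n : ℝ) / k⌉₊
  have hc : 0 < c := Nat.ceil_pos.2 (div_pos hnpos hkpos)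
  have hnck : n ≤ c * k := by
    have hle := (div_le_iff₀ hkpos).1 (Nat.le_ceil ((n : ℝ) / k))
    exact_mod_cast hle
  refine ⟨univ.filter fun j => N j < c, ?_, fun j hj => ?_⟩
  · have hcrowded := card_filter_le_of_sum_le hc (hN.trans hnck)
    have hcard := card_filter_add_card_filter_not (s := univ) fun j => N j < c
    simp only [not_lt, card_univ, Fintype.card_fin] at hcard
    omega
  · have hle : ((N j : ℝ) + 1) ≤ c := by exact_mod_cast (mem_filter.1 hj).2
    rw [one_div, inv_mul_le_iff₀ (Nat.cast_pos.2 hc)]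
    exact (h j).trans (mul_le_mul_of_nonneg_right hle (hX _))

variable {π : BoxIntegral.Prepartition C} {σ : Fin n → π.boxes} {F : π.boxes → Fin n → Rectangle}
  {N : ℕ} {home : Fin n → π.boxes → Prop} [DecidableEq π.boxes]

lemma isAllocation_of_isDivision (hF : ∀ J : π.boxes, IsDivision J.1 {i | σ i = J} v (F J)) :
    IsAllocation C fun i => F (σ i) i := by
  have hsub (i : Fin n) : (F (σ i) i : Set Plane) ⊆ (σ i).1 :=
    (hF (σ i)).subset i (by simp)
  refine ⟨fun i => (hsub i).trans (π.le_of_mem (σ i).2), fun i j hij => ?_⟩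
  by_cases hσ : σ i = σ j
  · rw [hσ]
    exact (hF (σ j)).disjoint i (by simp [hσ]) j (by simp) hij
  · exact (π.pairwiseDisjoint (σ i).2 (σ j).2 (mt Subtype.ext hσ)).mono (hsub i) (hsub j)

lemma value_le_load_mul_value (hF : ∀ J : π.boxes, IsDivision J.1 {i | σ i = J} v (F J))
    (i : Fin n) : value (v i) (σ i).1 ≤ load σ (σ i) * value (v i) (F (σ i) i) :=
  (hF (σ i)).proportional i (by simp)

lemma IsFairAssignment.value_le_mul_value (hπ : π.IsPartition)
    (hv : ∀ i, IsNonnegDensity C (v i))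
    (hσ : IsFairAssignment N (fun i J => value (v i) J.1) home σ)
    (hF : ∀ J : π.boxes, IsDivision J.1 {i | σ i = J} v (F J)) (i : Fin n) :
    value (v i) C ≤ N * value (v i) (F (σ i) i) := by
  have hpos : (0 : ℝ) < load σ (σ i) := Nat.cast_pos.2 (load_pos σ i)
  have hshare := hσ.share i
  rw [← value_eq_sum hπ (hv i).integrableOn] at hshare
  refine le_of_mul_le_mul_left ?_ hpos
  calc load σ (σ i) * value (v i) C ≤ N * value (v i) (σ i).1 := hshare
    _ ≤ N * (load σ (σ i) * value (v i) (F (σ i) i)) := by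
      gcongr
      exact value_le_load_mul_value hF i
    _ = load σ (σ i) * (N * value (v i) (F (σ i) i)) := mul_left_comm ..

lemma IsFairAssignment.value_le_load_add_one_mul_value (hN : 0 < N) (hπ : π.IsPartition)
    (hv : ∀ i, IsNonnegDensity C (v i))
    (hσ : IsFairAssignment N (fun i J => value (v i) J.1) home σ)
    (hF : ∀ J : π.boxes, IsDivision J.1 {i | σ i = J} v (F J)) {i : Fin n} {J : π.boxes}
    (hi : ∀ J', home i J' ↔ J' = J) :
    value (v i) J.1 ≤ (load σ J + 1) * value (v i) (F (σ i) i) := by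
  have hNpos : (0 : ℝ) < N := Nat.cast_pos.2 hN
  rcases hσ.home_or_le i J ((hi J).2 rfl) with hhome | haway
  · obtain rfl : σ i = J := (hi _).1 hhome
    have hnonneg : 0 ≤ value (v i) (F (σ i) i) := (hv i).value_nonneg
      ((isAllocation_of_isDivision hF).subset i) (F (σ i) i).measurableSet_coe
    refine (value_le_load_mul_value hF i).trans ?_
    gcongr
    exact le_add_of_nonneg_right zero_le_one
  · rw [← value_eq_sum hπ (hv i).integrableOn] at haway
    refine le_of_mul_le_mul_left ?_ hNpos
    calc N * value (v i) J.1 ≤ (load σ J + 1) * value (v i) C := haway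
      _ ≤ (load σ J + 1) * (N * value (v i) (F (σ i) i)) := by
        gcongr
        exact hσ.value_le_mul_value hπ hv hF i
      _ = N * ((load σ J + 1) * value (v i) (F (σ i) i)) := mul_left_comm ..

/-- The allocation `X` solves the redivision problem: it is `1 / 4`-proportional and the owners of
the old rectangles `Z` enjoy gradual retention. -/
def IsRedivision (hmn : m ≤ n) (C : Rectangle) (Z : Fin m → Rectangle) (v : Fin n → Plane → ℝ)
    (X : Fin n → Rectangle) : Prop :=
  IsAllocation C X ∧ IsProportional (1 / 4) C v X ∧ GradualRetention hmn v Z X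

lemma isRedivision_const_of_le_one (hn : n ≤ 1) (hmn : m ≤ n) (Z : Fin m → Rectangle)
    (hv : ∀ i, IsNonnegDensity C (v i)) : IsRedivision hmn C Z v fun _ => C := by
  have : Subsingleton (Fin n) := Fin.subsingleton_iff_le_one.2 hn
  refine ⟨⟨fun _ => subset_rfl, fun i j hij => (hij (Subsingleton.elim i j)).elim⟩, fun i => ?_,
    fun k hk _ => ⟨∅, by rw [card_empty]; omega, by simp⟩⟩
  have hn1 : (1 : ℝ) ≤ n := Nat.one_le_cast.2 i.pos
  refine mul_le_of_le_one_left ((hv i).value_nonneg subset_rfl C.measurableSet_coe) ?_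
  rw [div_le_one (by positivity)]
  linarith

lemma IsFairAssignment.isRedivision (hn : 0 < n) (hπ : π.IsPartition)
    (hv : ∀ i, IsNonnegDensity C (v i)) {piece : Fin m → π.boxes} (hinj : Injective piece)
    (hZ : ∀ j, Z j ≤ piece j)
    (hσ : IsFairAssignment (4 * n) (fun i J => value (v i) J.1)
      (fun i J => ∃ j, Fin.castLE hmn j = i ∧ J = piece j) σ)
    (hF : ∀ J : π.boxes, IsDivision J.1 {i | σ i = J} v (F J)) :
    IsRedivision hmn C Z v fun i => F (σ i) i := by
  have hX := isAllocation_of_isDivision hF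
  refine ⟨hX, fun i => ?_, gradualRetention_of_sum_le (N := fun j => load σ (piece j)) ?_
    (fun i => (hv i).value_nonneg (hX.subset i) (F (σ i) i).measurableSet_coe) fun j => ?_⟩
  · have hnpos : (0 : ℝ) < n := Nat.cast_pos.2 hn
    have hle := hσ.value_le_mul_value hπ hv hF i
    rw [div_div, one_div, inv_mul_le_iff₀ (mul_pos four_pos hnpos)]
    exact_mod_cast hle
  · calc ∑ j, load σ (piece j) = ∑ J ∈ univ.map ⟨piece, hinj⟩, load σ J := by
          rw [sum_map, Embedding.coeFn_mk]
      _ ≤ ∑ J, load σ J := sum_le_univ_sum_of_nonneg fun _ => Nat.zero_le _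
      _ = n := by rw [sum_load, Fintype.card_fin]
  · refine ((hv _).value_mono (hZ j) (π.le_of_mem (piece j).2)
      (piece j).1.measurableSet_coe).trans ?_
    refine hσ.value_le_load_add_one_mul_value (by positivity) hπ hv hF fun J => ?_
    simp only [Fin.castLE_inj, exists_eq_left]

lemma solvable_values (π : BoxIntegral.Prepartition C) {𝒱 : Set (Fin n → Plane → ℝ)} :
    Solvable C 𝒱 (fun v w => w = fun p : Fin n × π.boxes => value (v p.1) p.2.1)
      (n * #π.boxes) := by
  refine (Solvable.forall_mem (s := univ) fun p _ =>
    Solvable.eval p.1 (π.le_of_mem p.2.2)).mono subset_rfl ?_ ?_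
  · exact fun v _ w hw => funext fun p => hw p (mem_univ p)
  · simp

lemma solvable_forall_isDivision (σ : Fin n → π.boxes) {𝒱 : Set (Fin n → Plane → ℝ)}
    (h𝒱 : ∀ v ∈ 𝒱, ∀ i, IsNonnegDensity C (v i)) :
    Solvable C 𝒱
      (fun v (F : π.boxes → Fin n → Rectangle) => ∀ J, IsDivision J.1 {i | σ i = J} v (F J))
      (2 * n * Nat.clog 2 n) := by
  refine (Solvable.forall_mem (s := univ) fun (J : π.boxes) _ =>
    solvable_isDivision (Nat.clog 2 n) h𝒱 (π.le_of_mem J.2) ?_).mono subset_rfl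
      (fun v _ F hF J => hF J (mem_univ J)) ?_
  · calc #{i | σ i = J} ≤ n := card_finset_fin_le _
      _ ≤ 2 ^ Nat.clog 2 n := Nat.le_pow_clog one_lt_two n
  · rw [← sum_mul, ← mul_sum]
    have hload : ∑ J, #{i | σ i = J} = n := (sum_load σ).trans (Fintype.card_fin n)
    rw [hload]

lemma solvable_isRedivision (hn : 0 < n) (hZ : IsAllocation C Z) :
    Solvable C {v | ∀ i, IsNonnegDensity C (v i)} (IsRedivision hmn C Z)
      (n * (3 * m + 1) + 2 * n * Nat.clog 2 n) := by
  classical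
  obtain ⟨π, hπ, hcard, piece, hinj, hpiece⟩ :=
    exists_isPartition_of_pairwise_disjoint hZ.subset fun i j => hZ.disjoint i j
  rw [Fintype.card_fin] at hcard
  have : Nonempty π.boxes := hπ.nonempty_boxes.to_subtype
  refine ((solvable_values π).mono subset_rfl (fun _ _ _ h => h)
    (Nat.mul_le_mul_left n hcard)).bind fun w => .of_nonempty fun ⟨v, hv, hw⟩ => ?_
  have hw0 (i : Fin n) (J : π.boxes) : 0 ≤ w (i, J) := by
    rw [hw]
    exact (hv i).value_nonneg (π.le_of_mem J.2) J.1.measurableSet_coe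
  obtain ⟨σ, hσ⟩ := exists_isFairAssignment (N := 4 * n)
    (by rw [Fintype.card_fin, Fintype.card_coe]; omega) (fun i J => w (i, J)) hw0
    fun i J => ∃ j, Fin.castLE hmn j = i ∧ J = piece j
  refine (solvable_forall_isDivision σ fun v hv => hv.1).bind (p := 0) fun F => ?_
  refine .pure (fun i => F (σ i) i) ?_
  rintro v ⟨⟨hv, rfl⟩, hF⟩
  exact hσ.isRedivision hn hπ hv hinj hpiece hF

end Redivision

section QueryBound

variable {m n : ℕ}

lemma one_le_two_mul_log (hn : 2 ≤ n) : 1 ≤ 2 * Real.log n := by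
  have hlog : Real.log 2 ≤ Real.log n :=
    Real.log_le_log two_pos (by exact_mod_cast hn)
  linarith [Real.log_two_gt_d9]

lemma clog_two_le_four_mul_log (hn : 2 ≤ n) : Nat.clog 2 n ≤ 4 * Real.log n := by
  have hlog := one_le_two_mul_log hn
  have hlog2 : 1 ≤ 2 * Real.log 2 := by exact_mod_cast one_le_two_mul_log le_rfl
  have hlogb : Real.logb 2 n ≤ 2 * Real.log n := by
    rw [← Real.log_div_log, div_le_iff₀ (by linarith)]
    nlinarith
  have hceil : (⌈Real.logb 2 n⌉₊ : ℝ) < Real.logb 2 n + 1 :=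
    Nat.ceil_lt_add_one (Real.logb_nonneg one_lt_two (by exact_mod_cast one_le_two.trans hn))
  have hclog : ⌈Real.logb 2 n⌉₊ = Nat.clog 2 n := by exact_mod_cast Real.natCeil_logb_natCast 2 n
  rw [hclog] at hceil
  linarith

lemma query_count_le (hm : 1 ≤ m) (hn : 2 ≤ n) :
    ((n * (3 * m + 1) + 2 * n * Nat.clog 2 n : ℕ) : ℝ) ≤ 16 * (m * n * Real.log n) := by
  have hm' : (1 : ℝ) ≤ m := Nat.one_le_cast.2 hm
  have hlog := one_le_two_mul_log hn
  push_cast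
  calc (n : ℝ) * (3 * m + 1) + 2 * n * Nat.clog 2 n
      ≤ n * (4 * m) * (2 * Real.log n) + 2 * n * (4 * Real.log n) * m := by
        refine add_le_add ?_ ?_
        · calc (n : ℝ) * (3 * m + 1) ≤ n * (4 * m) := by gcongr; linarith
            _ ≤ n * (4 * m) * (2 * Real.log n) := le_mul_of_one_le_right (by positivity) hlog
        · calc 2 * (n : ℝ) * Nat.clog 2 n ≤ 2 * n * (4 * Real.log n) := by
                gcongr
                exact clog_two_le_four_mul_log hn
            _ ≤ 2 * n * (4 * Real.log n) * m := le_mul_of_one_le_right (by positivity) hm'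
    _ = 16 * (m * n * Real.log n) := by ring

end QueryBound
end CakeRedivision

theorem theorem4_general :
    ∃ K : ℝ, 0 < K ∧ ∀ (m n : ℕ) (_ : 1 ≤ m) (hmn : m ≤ n)
      (C : CakeRedivision.Rectangle) (Z : Fin m → CakeRedivision.Rectangle),
      CakeRedivision.IsAllocation C Z →
      ∃ (P : CakeRedivision.Protocol n (Fin n → CakeRedivision.Rectangle)) (q : ℕ),
        (q : ℝ) ≤ K * (m * n * Real.log n) ∧
        ∀ v : Fin n → CakeRedivision.Plane → ℝ,
          (∀ i, CakeRedivision.IsNonnegDensity C (v i)) →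
          P.Achieves C v (CakeRedivision.IsRedivision hmn C Z v) q := by
  refine ⟨16, by norm_num, fun m n hm hmn C Z hZ => ?_⟩
  rcases Nat.lt_or_ge 1 n with hn | hn
  · obtain ⟨P, hP⟩ := CakeRedivision.solvable_isRedivision (hmn := hmn) (by omega) hZ
    exact ⟨P, _, CakeRedivision.query_count_le hm hn, hP⟩
  · exact ⟨.done fun _ => C, 0, by rw [Nat.cast_zero]; positivity,
      fun v hv => CakeRedivision.isRedivision_const_of_le_one hn hmn Z hv⟩

theorem theorem4 :
    ∃ K : ℝ, 0 < K ∧ ∀ (m n : ℕ) (_ : 1 ≤ m) (hmn : m ≤ n)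
      (C : CakeRedivision.Rectangle) (Z : Fin m → CakeRedivision.Rectangle),
      CakeRedivision.IsAllocation C Z →
      ∃ (P : CakeRedivision.Protocol n (Fin n → CakeRedivision.Rectangle)) (q : ℕ),
        (q : ℝ) ≤ K * (m * n * Real.log n) ∧
        ∀ v : Fin n → CakeRedivision.Plane → ℝ,
          (∀ i, CakeRedivision.IsValueDensity C (v i)) →
          P.Achieves C v
            (fun X => CakeRedivision.IsAllocation C X ∧
              CakeRedivision.IsProportional (1 / 4) C v X ∧
              CakeRedivision.GradualRetention hmn v Z X) q := by
  obtain ⟨K, hK, h⟩ := theorem4_general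
  refine ⟨K, hK, fun m n hm hmn C Z hZ => ?_⟩
  obtain ⟨P, q, hq, hP⟩ := h m n hm hmn C Z hZ
  exact ⟨P, q, hq, fun v hv => hP v fun i => (hv i).isNonnegDensity⟩
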